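/- Let $d\ge 0$ be an integer and let $\gamma$ be the standard Gaussian measure on $\mathbb R^d$. For Borel probability measures $\mu,\nu$ on $\mathbb R^d$, let $W_2(\mu,\nu)\in[0,\infty]$ be the $L^2$ Kantorovich–Wasserstein distance, $W_2(\mu,\nu)^2=\inf_\pi\int|x-y|^2\,d\pi(x,y)$, the infimum being over all couplings $\pi$ of $\mu$ and $\nu$, and let $\mathrm{Ent}_\gamma(\mu)\in[0,\infty]$ be the relative entropy, equal to $\int\log\frac{d\mu}{d\gamma}\,d\mu$ if $\mu\ll\gamma$ and $+\infty$ otherwise. Then the following two statements are equivalent. (i) (Sharp symmetrized Talagrand inequality.) For every Borel probability measure $\mu$ on $\mathbb R^d$ with finite first moment and $\int x\,d\mu=0$, and every Borel probability measure $\nu$ on $\mathbb R^d$, $$W_2(\mu,\nu)^2\le 2\,\mathrm{Ent}_\gamma(\mu)+2\,\mathrm{Ent}_\gamma(\nu).$$ (ii) (Functional Santaló inequality.) For all Borel measurable functions $f,g:\mathbb R^d\to\mathbb R$ such that $f(x)+g(y)\le -x\cdot y$ for all $x,y\in\mathbb R^d$, and such that $e^f$ or $e^g$ has its barycenter at zero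 (that is, for $h=f$ or $h=g$, the functions $e^{h}$ and $x\,e^{h}$ are integrable and $\int x\,e^{h}\,dx=0$), $$\left(\int_{\mathbb R^d}e^f\,dx\right)\left(\int_{\mathbb R^d}e^g\,dx\right)\le(2\pi)^d.$$ -/

import Mathlib

open MeasureTheory ProbabilityTheory InformationTheory
open scoped ENNReal RealInnerProductSpace

/-- The couplings (transport plans) of `μ` and `ν`: the measures on the product space with first
marginal `μ` and second marginal `ν`. -/
def couplings {d : ℕ} (μ ν : Measure (EuclideanSpace ℝ (Fin d))) :
    Set (Measure (EuclideanSpace ℝ (Fin d) × EuclideanSpace ℝ (Fin d))) :=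
  {π | π.map Prod.fst = μ ∧ π.map Prod.snd = ν}

/-- The `L²` Kantorovich-Wasserstein distance, with values in `[0, ∞]`: the square root of the
infimum of `∫ |x - y|² dπ(x, y)` over all couplings `π` of `μ` and `ν`. -/
noncomputable def wassersteinTwo {d : ℕ} (μ ν : Measure (EuclideanSpace ℝ (Fin d))) : ℝ≥0∞ :=
  (⨅ π ∈ couplings μ ν, ∫⁻ p, ‖p.1 - p.2‖ₑ ^ 2 ∂π) ^ (1 / 2 : ℝ)

/-- A measure is centered: the identity is integrable and its integral (the barycenter, for
a probability measure) is zero. -/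
def IsCentered {d : ℕ} (μ : Measure (EuclideanSpace ℝ (Fin d))) : Prop :=
  Integrable (fun x => x) μ ∧ ∫ x, x ∂μ = 0

/-- The function `e ^ f` has its barycenter at zero: `e ^ f` and `x e ^ f` are Lebesgue integrable
and `∫ x e ^ f dx = 0`. -/
def ExpHasBarycenterZero {d : ℕ} (f : EuclideanSpace ℝ (Fin d) → ℝ) : Prop :=
  Integrable (fun x => Real.exp (f x)) ∧ Integrable (fun x => Real.exp (f x) • x) ∧
    ∫ x, Real.exp (f x) • x = 0

/-- The sharp symmetrized Talagrand inequality in dimension `d`. The relative entropy is the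
Kullback-Leibler divergence, with values in `[0, ∞]`. -/
def SymmetrizedTalagrandInequality (d : ℕ) : Prop :=
  ∀ μ ν : Measure (EuclideanSpace ℝ (Fin d)), IsProbabilityMeasure μ → IsProbabilityMeasure ν →
    IsCentered μ →
    wassersteinTwo μ ν ^ 2 ≤
      2 * klDiv μ (stdGaussian (EuclideanSpace ℝ (Fin d))) +
      2 * klDiv ν (stdGaussian (EuclideanSpace ℝ (Fin d)))

/-- The functional Santaló inequality in dimension `d`. -/
def FunctionalSantaloInequality (d : ℕ) : Prop :=
  ∀ f g : EuclideanSpace ℝ (Fin d) → ℝ, Measurable f → Measurable g →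
    (∀ x y, f x + g y ≤ -⟪x, y⟫) →
    (ExpHasBarycenterZero f ∨ ExpHasBarycenterZero g) →
    (∫⁻ x, ENNReal.ofReal (Real.exp (f x))) * (∫⁻ y, ENNReal.ofReal (Real.exp (g y))) ≤
      ENNReal.ofReal ((2 * Real.pi) ^ d)

/-! Both inequalities are dual to each other through two variational principles: Kantorovich duality
for the quadratic cost and the Donsker-Varadhan formula for the entropy. The dictionary is `φ = ‖x‖²
+ 2f`, `ψ = ‖y‖² + 2g`, under which `φ(x) + ψ(y) ≤ ‖x - y‖²` becomes `f(x) + g(y) ≤ -⟪x, y⟫`, while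
the Gaussian integral of `exp (φ / 2)` becomes `∫ e^f` divided by `(2π)^(d/2)`.

From Santaló to Talagrand: adding a linear term `⟪a, x⟫` to `f` moves its barycenter to zero, and
translating `g` by `a` restores the constraint. The linear term is invisible to the centered measure
`μ`, so Donsker-Varadhan for `μ` and `ν` bounds every dual value `∫ φ dμ + ∫ ψ dν`
(`FunctionalSantaloInequality.integral_add_integral_le`). Kantorovich duality
(`sq_wassersteinTwo_le_of_dual`) concludes; it is obtained by quantizing both measures and
separating convex sets in the finite problem.

From Talagrand to Santaló: apply the inequality to the normalized densities `e^f` and `e^g`. The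
potentials `φ`, `ψ` bound the distance from below, and their integrals also occur in the entropies.
They cancel, leaving only the logarithms of the normalizing constants
(`SymmetrizedTalagrandInequality.lintegral_mul_lintegral_le`). -/

/-! ### Gaussian integrals and the Lebesgue density of the standard Gaussian. -/

lemma integrable_exp_neg_mul_sq_norm_add {d : ℕ} {b : ℝ} (hb : 0 < b) (c : ℝ) :
    Integrable (fun x : EuclideanSpace ℝ (Fin d) => Real.exp (-b * ‖x‖ ^ 2 + c * ‖x‖)) := by
  have h0 : Integrable (fun x : EuclideanSpace ℝ (Fin d) => Real.exp (-(b / 2) * ‖x‖ ^ 2)) := by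
    refine Integrable.of_integral_ne_zero ?_
    rw [GaussianFourier.integral_rexp_neg_mul_sq_norm (by positivity)]
    positivity
  refine (h0.const_mul (Real.exp (c ^ 2 / (2 * b)))).mono' (by fun_prop) (ae_of_all _ fun x => ?_)
  rw [Real.norm_of_nonneg (Real.exp_pos _).le, ← Real.exp_add, Real.exp_le_exp]
  have h2 : c ^ 2 / (2 * b) + -(b / 2) * ‖x‖ ^ 2 - (-b * ‖x‖ ^ 2 + c * ‖x‖)
      = (c - b * ‖x‖) ^ 2 / (2 * b) := by field_simp; ring
  have : 0 ≤ (c - b * ‖x‖) ^ 2 / (2 * b) := by positivity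
  linarith

lemma integrable_exp_neg_half_sq_norm {d : ℕ} :
    Integrable (fun x : EuclideanSpace ℝ (Fin d) => Real.exp (-(‖x‖ ^ 2 / 2))) := by
  refine (integrable_exp_neg_mul_sq_norm_add (d := d) (b := 1 / 2) (by norm_num) 0).congr
    (ae_of_all _ fun x => ?_)
  simp only; congr 1; ring

lemma integral_exp_neg_half_sq_norm {d : ℕ} :
    ∫ x : EuclideanSpace ℝ (Fin d), Real.exp (-(‖x‖ ^ 2 / 2)) =
      (2 * Real.pi) ^ (d / 2 : ℝ) := by
  have := GaussianFourier.integral_rexp_neg_mul_sq_norm (V := EuclideanSpace ℝ (Fin d))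
    (b := 1 / 2) (by norm_num)
  rw [finrank_euclideanSpace_fin] at this
  rw [show 2 * Real.pi = Real.pi / (1 / 2) by ring, ← this]
  congr 1 with x; congr 1; ring

/-- The characteristic functions agree: that of the tilted measure is a Gaussian integral with
imaginary linear term. -/
lemma stdGaussian_eq_tilted (d : ℕ) :
    stdGaussian (EuclideanSpace ℝ (Fin d)) = volume.tilted (fun x => -(‖x‖ ^ 2 / 2)) := by
  have := isProbabilityMeasure_tilted (integrable_exp_neg_half_sq_norm (d := d))
  refine Measure.ext_of_charFun ?_
  ext t
  rw [charFun_stdGaussian, charFun_apply, integral_tilted, integral_exp_neg_half_sq_norm]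
  have key := GaussianFourier.integral_cexp_neg_mul_sq_norm_add
    (V := EuclideanSpace ℝ (Fin d)) (b := 1 / 2) (by norm_num) Complex.I t
  rw [finrank_euclideanSpace_fin] at key
  have h2 : ∀ x : EuclideanSpace ℝ (Fin d),
      (Real.exp (-(‖x‖ ^ 2 / 2)) / (2 * Real.pi) ^ (d / 2 : ℝ)) •
        Complex.exp (⟪x, t⟫ * Complex.I) =
      ((2 * Real.pi : ℂ) ^ (d / 2 : ℂ))⁻¹ *
        Complex.exp (-(1 / 2) * ‖x‖ ^ 2 + Complex.I * ⟪t, x⟫) := by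
    intro x
    rw [Complex.real_smul, Complex.ofReal_div, Complex.ofReal_cpow (by positivity),
      Complex.exp_add, real_inner_comm]
    push_cast
    rw [mul_comm Complex.I]
    rw [show (-((‖x‖ : ℂ) ^ 2 / 2)) = -(1 / 2) * (‖x‖ : ℂ) ^ 2 by ring]
    ring
  simp_rw [h2]
  rw [integral_const_mul, key, ← mul_assoc]
  have hpi : (Real.pi / (1 / 2) : ℂ) = 2 * Real.pi := by ring
  have hne : (2 * Real.pi : ℂ) ≠ 0 := by exact_mod_cast Real.two_pi_pos.ne'
  rw [hpi, inv_mul_cancel₀ (by simp [Complex.cpow_eq_zero_iff, hne]), one_mul]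
  congr 1
  simp only [Complex.I_sq]
  ring

lemma integrable_exp_stdGaussian_iff {d : ℕ} (h : EuclideanSpace ℝ (Fin d) → ℝ) :
    Integrable (fun x => Real.exp (h x)) (stdGaussian (EuclideanSpace ℝ (Fin d))) ↔
      Integrable (fun x => Real.exp (h x - ‖x‖ ^ 2 / 2)) := by
  rw [stdGaussian_eq_tilted, integrable_tilted_iff integrable_exp_neg_half_sq_norm]
  simp_rw [smul_eq_mul, ← Real.exp_add, neg_add_eq_sub]

lemma integral_exp_stdGaussian {d : ℕ} (h : EuclideanSpace ℝ (Fin d) → ℝ) :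
    ∫ x, Real.exp (h x) ∂(stdGaussian (EuclideanSpace ℝ (Fin d))) =
      (∫ x, Real.exp (h x - ‖x‖ ^ 2 / 2)) / (2 * Real.pi) ^ (d / 2 : ℝ) := by
  rw [stdGaussian_eq_tilted, integral_exp_tilted, integral_exp_neg_half_sq_norm]
  simp_rw [Pi.add_apply, neg_add_eq_sub]

/-! ### Variational bounds for the relative entropy. -/

section Entropy

variable {α : Type*} [MeasurableSpace α] {μ ν : Measure α} [IsProbabilityMeasure μ]
  [IsProbabilityMeasure ν]

lemma toReal_klDiv_eq_integral_llr (h : μ ≪ ν) : (klDiv μ ν).toReal = ∫ x, llr μ ν x ∂μ :=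
  toReal_klDiv_of_measure_eq h (by simp)

/-- The Donsker-Varadhan inequality. -/
lemma integral_le_toReal_klDiv_add_log (hkl : klDiv μ ν ≠ ∞) {h : α → ℝ} (hμ : Integrable h μ)
    (hν : Integrable (fun x => Real.exp (h x)) ν) :
    ∫ x, h x ∂μ ≤ (klDiv μ ν).toReal + Real.log (∫ x, Real.exp (h x) ∂ν) := by
  obtain ⟨hac, hint⟩ := klDiv_ne_top_iff.1 hkl
  have := isProbabilityMeasure_tilted hν
  have h1 := integral_llr_tilted_right hac hμ hν hint
  have hac' : μ ≪ ν.tilted h := hac.trans (absolutelyContinuous_tilted hν)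
  rw [← toReal_klDiv_eq_integral_llr hac, ← toReal_klDiv_eq_integral_llr hac'] at h1
  have : 0 ≤ (klDiv μ (ν.tilted h)).toReal := ENNReal.toReal_nonneg
  linarith

/-- Young's inequality for the Legendre pair `u log u - u` and `exp v`; it is `1 + s ≤ exp s` at `s
= v - log u`. -/
lemma mul_le_mul_log_sub_add_exp {u : ℝ} (hu : 0 ≤ u) (v : ℝ) :
    u * v ≤ u * Real.log u - u + Real.exp v := by
  rcases hu.eq_or_lt with rfl | hu
  · simpa using (Real.exp_pos v).le
  · have h1 := Real.add_one_le_exp (v - Real.log u)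
    rw [Real.exp_sub, Real.exp_log hu] at h1
    rw [le_div_iff₀ hu] at h1
    nlinarith

/-- Young's inequality with `u = dμ/dν` and `v = h` dominates the integrand `u * h` by
`ν`-integrable functions. -/
lemma integrable_of_klDiv_ne_top (hkl : klDiv μ ν ≠ ∞) {h : α → ℝ} (hm : Measurable h)
    (h0 : ∀ x, 0 ≤ h x) (hν : Integrable (fun x => Real.exp (h x)) ν) : Integrable h μ := by
  obtain ⟨hac, hint⟩ := klDiv_ne_top_iff.1 hkl
  rw [← integrable_rnDeriv_smul_iff hac]
  have h1 := (integrable_rnDeriv_mul_log_iff hac).2 hint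
  have h2 : Integrable (fun x => (μ.rnDeriv ν x).toReal) ν := Measure.integrable_toReal_rnDeriv
  refine ((h1.sub h2).add hν).mono' (by fun_prop) (ae_of_all _ fun x => ?_)
  rw [smul_eq_mul, Real.norm_of_nonneg (mul_nonneg ENNReal.toReal_nonneg (h0 x))]
  exact mul_le_mul_log_sub_add_exp ENNReal.toReal_nonneg _

/-- The relative entropy of an exponential tilt. -/
lemma klDiv_tilted_left {h : α → ℝ} (hν : Integrable (fun x => Real.exp (h x)) ν)
    (hh : Integrable h (ν.tilted h)) :
    klDiv (ν.tilted h) ν ≠ ∞ ∧ (klDiv (ν.tilted h) ν).toReal =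
      ∫ x, h x ∂(ν.tilted h) - Real.log (∫ x, Real.exp (h x) ∂ν) := by
  have := isProbabilityMeasure_tilted hν
  have hac := tilted_absolutelyContinuous ν h
  have h1 : llr (ν.tilted h) ν =ᵐ[ν.tilted h]
      fun x => h x - Real.log (∫ x, Real.exp (h x) ∂ν) :=
    hac.ae_le (log_rnDeriv_tilted_left_self hν)
  refine ⟨klDiv_ne_top hac ((integrable_congr h1).2 (hh.sub (integrable_const _))), ?_⟩
  rw [toReal_klDiv_eq_integral_llr hac, integral_congr_ae h1, integral_sub hh (integrable_const _)]
  simp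

end Entropy

/-! ### Recentering by a linear tilt. -/

section Tilt

variable {d : ℕ} {f : EuclideanSpace ℝ (Fin d) → ℝ} {b K : ℝ}

lemma integrable_exp_of_le (hf : Measurable f) (hb : 0 < b) (c : ℝ)
    (hle : ∀ x, f x ≤ K - b * ‖x‖ ^ 2 + c * ‖x‖) : Integrable (fun x => Real.exp (f x)) := by
  refine ((integrable_exp_neg_mul_sq_norm_add hb c).const_mul (Real.exp K)).mono' (by fun_prop)
    (ae_of_all _ fun x => ?_)
  rw [Real.norm_of_nonneg (Real.exp_pos _).le, ← Real.exp_add, Real.exp_le_exp]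
  linarith [hle x]

lemma integrable_exp_add_inner (hf : Measurable f) (hb : 0 < b)
    (hle : ∀ x, f x ≤ K - b * ‖x‖ ^ 2) (a : EuclideanSpace ℝ (Fin d)) :
    Integrable (fun x => Real.exp (f x + ⟪a, x⟫)) :=
  integrable_exp_of_le (K := K) (by fun_prop) hb ‖a‖ fun x => by
    linarith [hle x, real_inner_le_norm a x]

lemma continuous_integral_exp_add_inner (hf : Measurable f) (hb : 0 < b)
    (hle : ∀ x, f x ≤ K - b * ‖x‖ ^ 2) :
    Continuous fun a : EuclideanSpace ℝ (Fin d) => ∫ x, Real.exp (f x + ⟪a, x⟫) := by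
  refine continuous_iff_continuousAt.2 fun a₀ => ?_
  refine continuousAt_of_dominated (bound := fun x => Real.exp (f x + (‖a₀‖ + 1) * ‖x‖))
    (Filter.Eventually.of_forall fun a => by fun_prop) ?_ ?_ (ae_of_all _ fun x => by fun_prop)
  · filter_upwards [Metric.ball_mem_nhds a₀ one_pos] with a ha
    refine ae_of_all _ fun x => ?_
    rw [Real.norm_of_nonneg (Real.exp_pos _).le, Real.exp_le_exp]
    have h1 : ‖a‖ ≤ ‖a₀‖ + 1 := by
      have := norm_le_norm_add_norm_sub' a a₀
      rw [← dist_eq_norm] at this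
      linarith [Metric.mem_ball.1 ha]
    linarith [real_inner_le_norm a x, mul_le_mul_of_nonneg_right h1 (norm_nonneg x)]
  · exact integrable_exp_of_le (K := K) (by fun_prop) hb (‖a₀‖ + 1) fun x => by linarith [hle x]

/-- Completing the square in the quadratic lower bound, which is the translation by `a / (2K)`. This
gives coercivity in `a`. -/
lemma exp_mul_integral_le_integral_exp_add_inner (hf : Measurable f) (hb : 0 < b) (hK : 0 < K)
    (hle : ∀ x, f x ≤ K - b * ‖x‖ ^ 2) (hge : ∀ x, -(K * (1 + ‖x‖ ^ 2)) ≤ f x)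
    (a : EuclideanSpace ℝ (Fin d)) :
    Real.exp (‖a‖ ^ 2 / (4 * K)) *
        ∫ x : EuclideanSpace ℝ (Fin d), Real.exp (-(K * (1 + ‖x‖ ^ 2))) ≤
      ∫ x, Real.exp (f x + ⟪a, x⟫) := by
  have h0 : Integrable fun x : EuclideanSpace ℝ (Fin d) => Real.exp (-(K * (1 + ‖x‖ ^ 2))) :=
    integrable_exp_of_le (K := 0) (by fun_prop) hK 0 fun x => by linarith
  rw [← integral_sub_right_eq_self _ ((1 / (2 * K)) • a), ← integral_const_mul]
  refine integral_mono ((h0.comp_sub_right _).const_mul _)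
    (integrable_exp_add_inner hf hb hle a) fun x => ?_
  simp only
  rw [← Real.exp_add, Real.exp_le_exp, norm_sub_sq_real, inner_smul_right, norm_smul,
    real_inner_comm, Real.norm_of_nonneg (by positivity)]
  have h1 := hge x
  have h2 : ‖a‖ ^ 2 / (4 * K) + -(K * (1 + (‖x‖ ^ 2 - 2 * (1 / (2 * K) * ⟪a, x⟫) +
      (1 / (2 * K) * ‖a‖) ^ 2))) = -(K * (1 + ‖x‖ ^ 2)) + ⟪a, x⟫ := by
    field_simp; ring
  linarith

/-- The gradient in `a` of the integral is the unnormalized barycenter. It is computed direction by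
direction: along `v` the normalized integral is the moment generating function of `⟪v, x⟫`, whose
derivative at `0` is the mean. -/
lemma expHasBarycenterZero_of_isMin (hf : Measurable f) (hb : 0 < b)
    (hle : ∀ x, f x ≤ K - b * ‖x‖ ^ 2) {a : EuclideanSpace ℝ (Fin d)}
    (ha : ∀ a', ∫ x, Real.exp (f x + ⟪a, x⟫) ≤ ∫ x, Real.exp (f x + ⟪a', x⟫)) :
    ExpHasBarycenterZero (fun x => f x + ⟪a, x⟫) := by
  have hI := integrable_exp_add_inner hf hb hle
  have := isProbabilityMeasure_tilted (hI a)
  set m := volume.tilted (fun x => f x + ⟪a, x⟫) with hm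
  have hZ : 0 < ∫ x, Real.exp (f x + ⟪a, x⟫) := integral_exp_pos (hI a)
  have hint : Integrable (fun x => Real.exp (f x + ⟪a, x⟫) • x) := by
    refine Integrable.mono' (integrable_exp_of_le (K := K) (f := fun x => f x + (‖a‖ + 1) * ‖x‖)
      (by fun_prop) hb (‖a‖ + 1) fun x => by linarith [hle x]) (by fun_prop)
      (ae_of_all _ fun x => ?_)
    rw [norm_smul, Real.norm_of_nonneg (Real.exp_pos _).le]
    calc Real.exp (f x + ⟪a, x⟫) * ‖x‖ ≤ Real.exp (f x + ‖a‖ * ‖x‖) * Real.exp ‖x‖ := by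
          gcongr
          · exact real_inner_le_norm a x
          · linarith [Real.add_one_le_exp ‖x‖]
      _ = _ := by rw [← Real.exp_add]; congr 1; ring
  refine ⟨hI a, hint, ?_⟩
  have hmint : Integrable (fun x => x) m := (integrable_tilted_iff (hI a) _).2 hint
  have hmgf : ∀ v t, mgf (fun x => ⟪v, x⟫) m t =
      (∫ x, Real.exp (f x + ⟪a + t • v, x⟫)) / ∫ x, Real.exp (f x + ⟪a, x⟫) := by
    intro v t
    rw [mgf, hm, integral_exp_tilted]
    congr 3 with x
    rw [Pi.add_apply, inner_add_left, real_inner_smul_left, add_assoc]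
  have hset : ∀ v, integrableExpSet (fun x => ⟪v, x⟫) m = Set.univ := by
    refine fun v => Set.eq_univ_of_forall fun t => ?_
    rw [integrableExpSet, Set.mem_ofPred, hm, integrable_tilted_iff (hI a)]
    refine (hI (a + t • v)).congr (ae_of_all _ fun x => ?_)
    simp only
    rw [smul_eq_mul, ← Real.exp_add, inner_add_left, real_inner_smul_left, add_assoc]
  have hzero : ∫ x, x ∂m = 0 := by
    refine ext_inner_left ℝ fun v => ?_
    rw [inner_zero_right, ← integral_inner hmint v]
    have h1 := deriv_mgf_zero (X := fun x => ⟪v, x⟫) (μ := m) (by simp [hset])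
    rw [← h1]
    refine IsLocalMin.deriv_eq_zero (Filter.Eventually.of_forall fun t => ?_)
    rw [hmgf, hmgf, zero_smul, add_zero]
    exact div_le_div_of_nonneg_right (ha _) hZ.le
  rw [hm, integral_tilted] at hzero
  simp_rw [div_eq_inv_mul, ← smul_smul] at hzero
  rw [integral_smul] at hzero
  exact (smul_eq_zero.1 hzero).resolve_left (inv_ne_zero hZ.ne')

/-- The integral is continuous and coercive in `a`, hence attains its minimum. -/
lemma exists_expHasBarycenterZero_add_inner (hf : Measurable f) (hb : 0 < b) (hK : 0 < K)
    (hle : ∀ x, f x ≤ K - b * ‖x‖ ^ 2) (hge : ∀ x, -(K * (1 + ‖x‖ ^ 2)) ≤ f x) :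
    ∃ a : EuclideanSpace ℝ (Fin d), ExpHasBarycenterZero (fun x => f x + ⟪a, x⟫) := by
  have h0 : Integrable fun x : EuclideanSpace ℝ (Fin d) => Real.exp (-(K * (1 + ‖x‖ ^ 2))) :=
    integrable_exp_of_le (K := 0) (by fun_prop) hK 0 fun x => by linarith
  have hlim : Filter.Tendsto (fun a : EuclideanSpace ℝ (Fin d) => ∫ x, Real.exp (f x + ⟪a, x⟫))
      (Filter.cocompact _) Filter.atTop := by
    refine Filter.tendsto_atTop_mono
      (exp_mul_integral_le_integral_exp_add_inner hf hb hK hle hge) ?_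
    refine Filter.Tendsto.atTop_mul_const (integral_exp_pos h0)
      (Real.tendsto_exp_atTop.comp (Filter.Tendsto.atTop_div_const (by positivity) ?_))
    exact (Filter.tendsto_pow_atTop two_ne_zero).comp tendsto_norm_cocompact_atTop
  obtain ⟨a, ha⟩ := (continuous_integral_exp_add_inner hf hb hle).exists_forall_le hlim
  exact ⟨a, expHasBarycenterZero_of_isMin hf hb hle ha⟩

end Tilt

/-! ### Admissible potentials and the dual Talagrand bound. -/

/-- Quadratic lower bound and constant upper bound with the same constant. -/
def IsQuadraticallyBounded {d : ℕ} (φ : EuclideanSpace ℝ (Fin d) → ℝ) : Prop :=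
  ∃ K, 0 < K ∧ ∀ x, -(K * (1 + ‖x‖ ^ 2)) ≤ φ x ∧ φ x ≤ K

section Moments

variable {d : ℕ} {μ : Measure (EuclideanSpace ℝ (Fin d))} [IsProbabilityMeasure μ]

lemma integrable_sq_norm_of_klDiv_ne_top
    (h : klDiv μ (stdGaussian (EuclideanSpace ℝ (Fin d))) ≠ ∞) :
    Integrable (fun x => ‖x‖ ^ 2) μ := by
  -- The factor `1 / 4` is below the Gaussian rate `1 / 2`, so `exp (‖x‖² / 4)` is
  -- Gaussian-integrable.
  have h1 : Integrable (fun x : EuclideanSpace ℝ (Fin d) => ‖x‖ ^ 2 / 4) μ := by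
    refine integrable_of_klDiv_ne_top h (by fun_prop) (fun x => by positivity) ?_
    rw [integrable_exp_stdGaussian_iff]
    exact integrable_exp_of_le (b := 1 / 4) (K := 0) (by fun_prop) (by norm_num) 0
      fun x => by linarith
  exact (h1.const_mul 4).congr (ae_of_all _ fun x => by ring)

lemma IsQuadraticallyBounded.integrable {φ : EuclideanSpace ℝ (Fin d) → ℝ}
    (hφ : IsQuadraticallyBounded φ) (hm : Measurable φ) (h2 : Integrable (fun x => ‖x‖ ^ 2) μ) :
    Integrable φ μ := by
  obtain ⟨K, hK, h⟩ := hφ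
  refine (((integrable_const (1 : ℝ)).add h2).const_mul K).mono' (by fun_prop)
    (ae_of_all _ fun x => abs_le.2 ⟨?_, ?_⟩)
  · exact (h x).1
  · refine (h x).2.trans (le_mul_of_one_le_right hK.le ?_)
    simp only [Pi.add_apply]; nlinarith [sq_nonneg ‖x‖]

/-- The entropy duality bound for the potential `φ`, with a linear term `a`. -/
lemma integral_half_le_klDiv_add_log {φ : EuclideanSpace ℝ (Fin d) → ℝ}
    (hφ : IsQuadraticallyBounded φ) (hm : Measurable φ)
    (hkl : klDiv μ (stdGaussian (EuclideanSpace ℝ (Fin d))) ≠ ∞)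
    (a : EuclideanSpace ℝ (Fin d)) (ha : ∫ x, ⟪a, x⟫ ∂μ = 0) (hai : Integrable (fun x => ⟪a, x⟫) μ) :
    ∫ x, φ x / 2 ∂μ ≤ (klDiv μ (stdGaussian (EuclideanSpace ℝ (Fin d)))).toReal +
      Real.log ((∫ x, Real.exp ((φ x - ‖x‖ ^ 2) / 2 + ⟪a, x⟫)) / (2 * Real.pi) ^ (d / 2 : ℝ)) := by
  have hφi := (hφ.integrable hm (integrable_sq_norm_of_klDiv_ne_top hkl)).div_const 2
  obtain ⟨K, hK, h⟩ := hφ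
  have heq : ∀ x, φ x / 2 + ⟪a, x⟫ - ‖x‖ ^ 2 / 2 = (φ x - ‖x‖ ^ 2) / 2 + ⟪a, x⟫ :=
    fun x => by ring
  have hexp : Integrable (fun x => Real.exp ((φ x - ‖x‖ ^ 2) / 2 + ⟪a, x⟫)) :=
    integrable_exp_add_inner (b := 1 / 2) (K := K) (by fun_prop) (by norm_num)
      (fun x => by linarith [(h x).2]) a
  have h1 := integral_le_toReal_klDiv_add_log hkl (hφi.add hai) <| by
    rw [integrable_exp_stdGaussian_iff]; simpa only [Pi.add_apply, heq] using hexp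
  rw [integral_exp_stdGaussian, integral_add' hφi hai, ha, add_zero] at h1
  simpa only [Pi.add_apply, heq] using h1

end Moments

/-- The dual form of the symmetrized Talagrand inequality. -/
lemma FunctionalSantaloInequality.integral_add_integral_le {d : ℕ}
    (H : FunctionalSantaloInequality d) {μ ν : Measure (EuclideanSpace ℝ (Fin d))}
    [IsProbabilityMeasure μ] [IsProbabilityMeasure ν] (hc : IsCentered μ)
    (hμ : klDiv μ (stdGaussian (EuclideanSpace ℝ (Fin d))) ≠ ∞)
    (hν : klDiv ν (stdGaussian (EuclideanSpace ℝ (Fin d))) ≠ ∞)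
    {φ ψ : EuclideanSpace ℝ (Fin d) → ℝ} (hφm : Measurable φ) (hψm : Measurable ψ)
    (hφ : IsQuadraticallyBounded φ) (hψ : IsQuadraticallyBounded ψ)
    (hle : ∀ x y, φ x + ψ y ≤ ‖x - y‖ ^ 2) :
    ∫ x, φ x ∂μ + ∫ y, ψ y ∂ν ≤
      2 * (klDiv μ (stdGaussian (EuclideanSpace ℝ (Fin d)))).toReal +
      2 * (klDiv ν (stdGaussian (EuclideanSpace ℝ (Fin d)))).toReal := by
  obtain ⟨a, ha⟩ : ∃ a, ExpHasBarycenterZero (fun x => (φ x - ‖x‖ ^ 2) / 2 + ⟪a, x⟫) := by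
    obtain ⟨K, hK, h⟩ := hφ
    refine exists_expHasBarycenterZero_add_inner (b := 1 / 2) (K := K + 1) (by fun_prop)
      (by norm_num) (by positivity) (fun x => by linarith [(h x).2]) fun x => ?_
    nlinarith [(h x).1, sq_nonneg ‖x‖, mul_nonneg hK.le (sq_nonneg ‖x‖)]
  have hg : Integrable (fun y => Real.exp ((ψ y - ‖y‖ ^ 2) / 2 + ⟪(0 : EuclideanSpace ℝ (Fin d)), y⟫)) := by
    obtain ⟨K, hK, h⟩ := hψ
    exact integrable_exp_add_inner (b := 1 / 2) (K := K) (by fun_prop) (by norm_num)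
      (fun x => by linarith [(h x).2]) 0
  have hpos : (0 : ℝ) < (2 * Real.pi) ^ (d / 2 : ℝ) := by positivity
  -- Translating the second function by `a` produces `-⟪x, a⟫`, which cancels the tilt of the first
  -- and leaves its integral unchanged.
  have hprod := H _ (fun y => (ψ (y + a) - ‖y + a‖ ^ 2) / 2) (by fun_prop) (by fun_prop)
    (fun x y => by
      have h1 := hle x (y + a)
      rw [norm_sub_sq_real, inner_add_right, real_inner_comm a] at h1
      have := real_inner_comm a x
      linarith) (Or.inl ha)
  rw [lintegral_add_right_eq_self (fun y => ENNReal.ofReal (Real.exp ((ψ y - ‖y‖ ^ 2) / 2))) a,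
    ← ofReal_integral_eq_lintegral_ofReal ha.1 (ae_of_all _ fun _ => (Real.exp_pos _).le),
    ← ofReal_integral_eq_lintegral_ofReal (by simpa using hg)
      (ae_of_all _ fun _ => (Real.exp_pos _).le),
    ← ENNReal.ofReal_mul (integral_exp_pos ha.1).le, ENNReal.ofReal_le_ofReal_iff (by positivity)]
    at hprod
  -- Centering of `μ` is used here: the tilt has zero mean.
  have h1 := integral_half_le_klDiv_add_log hφ hφm hμ a
    (by rw [integral_inner hc.1, hc.2, inner_zero_right]) (hc.1.const_inner a)
  have h2 := integral_half_le_klDiv_add_log hψ hψm hν 0 (by simp) (by simp)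
  rw [integral_div] at h1 h2
  have hA := integral_exp_pos ha.1
  have hB := integral_exp_pos hg
  have hlog : Real.log ((∫ x, Real.exp ((φ x - ‖x‖ ^ 2) / 2 + ⟪a, x⟫)) / (2 * Real.pi) ^ (d / 2 : ℝ))
      + Real.log ((∫ x, Real.exp ((ψ x - ‖x‖ ^ 2) / 2 + ⟪(0 : EuclideanSpace ℝ (Fin d)), x⟫)) /
        (2 * Real.pi) ^ (d / 2 : ℝ)) ≤ 0 := by
    rw [← Real.log_mul (by positivity) (by positivity)]
    refine Real.log_nonpos (by positivity) ?_
    rw [div_mul_div_comm, div_le_one (by positivity), ← Real.rpow_add (by positivity),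
      add_halves, Real.rpow_natCast]
    simpa using hprod
  linarith

/-! ### Finite Kantorovich duality by convex separation. -/

section FiniteDuality

variable {ι κ : Type*} [Fintype ι] [Fintype κ]

/-- The row sums, the column sums and the cost of a finite plan. -/
def planData (c : ι → κ → ℝ) : (ι × κ → ℝ) →ₗ[ℝ] (ι → ℝ) × (κ → ℝ) × ℝ where
  toFun p := (fun i => ∑ j, p (i, j), fun j => ∑ i, p (i, j), ∑ i, ∑ j, p (i, j) * c i j)
  map_add' p q := by
    ext <;> simp [Finset.sum_add_distrib, add_mul]
  map_smul' r p := by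
    ext <;> simp [Finset.mul_sum, mul_assoc]

lemma exists_coeffs_strongDual (F : StrongDual ℝ ((ι → ℝ) × (κ → ℝ) × ℝ)) :
    ∃ (u : ι → ℝ) (v : κ → ℝ) (t : ℝ), ∀ x y z,
      F (x, y, z) = ∑ i, u i * x i + ∑ j, v j * y j + t * z := by
  classical
  refine ⟨fun i => F (fun k => if i = k then 1 else 0, 0, 0),
    fun j => F (0, fun k => if j = k then 1 else 0, 0), F (0, 0, 1),
    fun x y z => ?_⟩
  have h1 : F (x, 0, 0) = ∑ i, F (fun k => if i = k then 1 else 0, 0, 0) * x i := by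
    have := LinearMap.pi_apply_eq_sum_univ
      (F.toLinearMap ∘ₗ LinearMap.inl ℝ (ι → ℝ) ((κ → ℝ) × ℝ)) x
    simp_rw [smul_eq_mul, mul_comm (x _)] at this
    exact this
  have h2 : F (0, y, 0) = ∑ j, F (0, fun k => if j = k then 1 else 0, 0) * y j := by
    have := LinearMap.pi_apply_eq_sum_univ
      (F.toLinearMap ∘ₗ LinearMap.inr ℝ (ι → ℝ) ((κ → ℝ) × ℝ) ∘ₗ LinearMap.inl ℝ (κ → ℝ) ℝ) y
    simpa [mul_comm] using this
  have h3 : F (0, 0, z) = F (0, 0, 1) * z := by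
    have := F.map_smul z ((0, 0, 1) : (ι → ℝ) × (κ → ℝ) × ℝ)
    simpa [mul_comm] using this
  rw [← h1, ← h2, ← h3, ← map_add, ← map_add]
  simp

/-- Kantorovich duality for finite spaces. -/
lemma exists_finite_plan {a : ι → ℝ} {b : κ → ℝ} (ha : ∀ i, 0 ≤ a i) (hb : ∀ j, 0 ≤ b j)
    (ha1 : ∑ i, a i = 1) (hb1 : ∑ j, b j = 1) (c : ι → κ → ℝ) {X : ℝ}
    (h : ∀ (u : ι → ℝ) (v : κ → ℝ), (∀ i j, u i + v j ≤ c i j) →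
      ∑ i, u i * a i + ∑ j, v j * b j ≤ X) :
    ∃ p : ι → κ → ℝ, (∀ i j, 0 ≤ p i j) ∧ (∀ i, ∑ j, p i j = a i) ∧ (∀ j, ∑ i, p i j = b j) ∧
      ∑ i, ∑ j, p i j * c i j ≤ X := by
  classical
  -- A common point of `s` and `t` is a plan with the right marginals and cost at most `X`;
  -- otherwise Hahn-Banach separates them.
  set s := planData c '' stdSimplex ℝ (ι × κ)
  set t : Set ((ι → ℝ) × (κ → ℝ) × ℝ) := {a} ×ˢ {b} ×ˢ Set.Iic X
  have hs : Convex ℝ s := (convex_stdSimplex ℝ _).linear_image _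
  have hsc : IsCompact s :=
    (isCompact_stdSimplex ℝ (ι × κ)).image (planData c).continuous_of_finiteDimensional
  have ht : Convex ℝ t := (convex_singleton a).prod ((convex_singleton b).prod (convex_Iic X))
  have htc : IsClosed t := isClosed_singleton.prod (isClosed_singleton.prod isClosed_Iic)
  by_cases hdisj : Disjoint s t
  · exfalso
    obtain ⟨F, α, β, hFs, hαβ, hFt⟩ := geometric_hahn_banach_compact_closed hs hsc ht htc hdisj
    obtain ⟨u, v, τ, hF⟩ := exists_coeffs_strongDual F
    have hvert : ∀ i j, u i + v j + τ * c i j < α := by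
      intro i j
      have := hFs _ ⟨Pi.single (i, j) 1, single_mem_stdSimplex ℝ (i, j), rfl⟩
      have hd : planData c (Pi.single (i, j) 1) = (Pi.single i 1, Pi.single j 1, c i j) := by
        ext k
        · simp [planData, Pi.single_apply, Prod.ext_iff, ite_and]
        · simp [planData, Pi.single_apply, Prod.ext_iff, ite_and]
        · simp [planData, Pi.single_apply, Prod.ext_iff, ite_and]
      rw [hd, hF] at this
      simpa [Pi.single_apply] using this
    have htarget : ∀ z ≤ X, β < ∑ i, u i * a i + ∑ j, v j * b j + τ * z := by
      intro z hz
      rw [← hF]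
      exact hFt _ ⟨rfl, rfl, hz⟩
    set V := ∑ i, u i * a i + ∑ j, v j * b j
    -- The set `t` is unbounded below in the cost direction.
    have hτ : τ ≤ 0 := by
      by_contra! hτ
      have h1 := htarget (min X ((β - V) / τ)) (min_le_left _ _)
      have h2 : τ * min X ((β - V) / τ) ≤ τ * ((β - V) / τ) := by gcongr; exact min_le_right _ _
      rw [mul_div_cancel₀ _ hτ.ne'] at h2
      linarith
    have hX := htarget X le_rfl
    -- If `τ = 0`, averaging the vertex bounds over the product plan `a i * b j` gives a
    -- contradiction. If `τ < 0`, dividing by `-τ` gives feasible potentials of value above `X`.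
    rcases hτ.eq_or_lt with rfl | hτ
    · have h1 : ∑ i, ∑ j, a i * b j * (u i + v j) ≤ ∑ i, ∑ j, a i * b j * α := by
        refine Finset.sum_le_sum fun i _ => Finset.sum_le_sum fun j _ => ?_
        have := hvert i j
        exact mul_le_mul_of_nonneg_left (by linarith) (mul_nonneg (ha i) (hb j))
      have h2 : ∑ i, ∑ j, a i * b j * α = α := by
        simp_rw [← Finset.sum_mul, ← Finset.mul_sum, hb1, mul_one, ha1, one_mul]
      have h3 : ∑ i, ∑ j, a i * b j * (u i + v j) = V := by
        simp_rw [mul_add, Finset.sum_add_distrib]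
        congr 1
        · refine Finset.sum_congr rfl fun i _ => ?_
          rw [← Finset.sum_mul, ← Finset.mul_sum, hb1]
          ring
        · rw [Finset.sum_comm]
          refine Finset.sum_congr rfl fun j _ => ?_
          simp_rw [mul_assoc]
          rw [← Finset.sum_mul, ha1]
          ring
      linarith
    · have hτ' : 0 < -τ := by linarith
      have h1 := h (fun i => (u i - α) / (-τ)) (fun j => v j / (-τ)) fun i j => by
        rw [← add_div, div_le_iff₀ hτ']
        linarith [hvert i j]
      have h2 : ∑ i, (u i - α) / (-τ) * a i + ∑ j, v j / (-τ) * b j = (V - α) / (-τ) := by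
        simp_rw [div_mul_eq_mul_div, ← Finset.sum_div, ← add_div, sub_mul,
          Finset.sum_sub_distrib, ← Finset.mul_sum, ha1]
        congr 1
        ring
      rw [h2, div_le_iff₀ hτ'] at h1
      linarith
  · obtain ⟨_, ⟨p, hp, rfl⟩, h1, h2, h3⟩ := Set.not_disjoint_iff.1 hdisj
    exact ⟨fun i j => p (i, j), fun i j => hp.1 _, fun i => congrFun h1 i, fun j => congrFun h2 j,
      h3⟩

end FiniteDuality

/-! ### Lifting a finite plan to a coupling. -/

section Gluing

variable {α β ι κ : Type*} [MeasurableSpace α] [MeasurableSpace β]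
  [Fintype ι] [MeasurableSpace ι] [DiscreteMeasurableSpace ι] [Fintype κ]

/-- Computes a marginal of the glued coupling. The factor `m j` is the mass of the other conditional
measure, which vanishes when its cell is null; the plan gives such cells no weight. -/
lemma sum_ofReal_smul_cond_fiber (μ : Measure α) [IsProbabilityMeasure μ] {S : α → ι}
    (hS : Measurable S) {p : ι → κ → ℝ} (hp : ∀ i j, 0 ≤ p i j)
    (hrow : ∀ i, ∑ j, p i j = μ.real (S ⁻¹' {i})) (m : κ → ℝ≥0∞)
    (hm : ∀ j, m j ≠ 1 → ∀ i, p i j = 0) :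
    ∑ i, ∑ j, (ENNReal.ofReal (p i j) * m j) • μ[|S ⁻¹' {i}] = μ := by
  conv_rhs => rw [← sum_meas_smul_cond_fiber hS μ]
  refine Finset.sum_congr rfl fun i _ => ?_
  rw [← Finset.sum_smul]
  congr 1
  rw [← ofReal_measureReal, ← hrow, ENNReal.ofReal_sum_of_nonneg fun j _ => hp i j]
  refine Finset.sum_congr rfl fun j _ => ?_
  by_cases h : m j = 1
  · rw [h, mul_one]
  · rw [hm j h i]; simp

variable [MeasurableSpace κ] [DiscreteMeasurableSpace κ]

/-- A plan between the laws of two finite-valued maps lifts to a plan between the measures. -/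
lemma exists_coupling_of_finite_plan (μ : Measure α) (ν : Measure β) [IsProbabilityMeasure μ]
    [IsProbabilityMeasure ν] {S : α → ι} {T : β → κ} (hS : Measurable S) (hT : Measurable T)
    {p : ι → κ → ℝ} (hp : ∀ i j, 0 ≤ p i j) (hrow : ∀ i, ∑ j, p i j = μ.real (S ⁻¹' {i}))
    (hcol : ∀ j, ∑ i, p i j = ν.real (T ⁻¹' {j})) :
    ∃ π : Measure (α × β), π.map Prod.fst = μ ∧ π.map Prod.snd = ν ∧
      ∀ c : ι → κ → ℝ≥0∞, ∫⁻ q, c (S q.1) (T q.2) ∂π ≤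
        ∑ i, ∑ j, ENNReal.ofReal (p i j) * c i j := by
  have huniv : ∀ i, μ[|S ⁻¹' {i}] Set.univ ≠ 1 → μ.real (S ⁻¹' {i}) = 0 := by
    intro i hi
    by_contra h0
    have := cond_isProbabilityMeasure (μ := μ) (s := S ⁻¹' {i})
      fun h => h0 (by simp [measureReal_def, h])
    exact hi measure_univ
  have huniv' : ∀ j, ν[|T ⁻¹' {j}] Set.univ ≠ 1 → ν.real (T ⁻¹' {j}) = 0 := by
    intro i hi
    by_contra h0
    have := cond_isProbabilityMeasure (μ := ν) (s := T ⁻¹' {i})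
      fun h => h0 (by simp [measureReal_def, h])
    exact hi measure_univ
  -- Inside each pair of cells, the two conditional measures are taken independent.
  refine ⟨∑ i, ∑ j, ENNReal.ofReal (p i j) • (μ[|S ⁻¹' {i}]).prod (ν[|T ⁻¹' {j}]), ?_, ?_, ?_⟩
  · conv_rhs => rw [← sum_ofReal_smul_cond_fiber μ hS hp hrow (fun j => ν[|T ⁻¹' {j}] Set.univ)
      fun j hj i => (Finset.sum_eq_zero_iff_of_nonneg fun i _ => hp i j).1
        ((hcol j).trans (huniv' j hj)) i (Finset.mem_univ i)]
    rw [← Measure.mapₗ_apply_of_measurable measurable_fst]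
    simp_rw [map_sum, map_smul, Measure.mapₗ_apply_of_measurable measurable_fst,
      Measure.map_fst_prod, smul_smul]
  · conv_rhs => rw [← sum_ofReal_smul_cond_fiber ν hT (fun j i => hp i j) hcol
      (fun i => μ[|S ⁻¹' {i}] Set.univ)
      fun i hi j => (Finset.sum_eq_zero_iff_of_nonneg fun j _ => hp i j).1
        ((hrow i).trans (huniv i hi)) j (Finset.mem_univ j)]
    rw [← Measure.mapₗ_apply_of_measurable measurable_snd, Finset.sum_comm]
    simp_rw [map_sum, map_smul, Measure.mapₗ_apply_of_measurable measurable_snd,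
      Measure.map_snd_prod, smul_smul]
  · intro c
    simp_rw [lintegral_finsetSum_measure, lintegral_smul_measure, smul_eq_mul]
    gcongr with i _ j _
    have h1 : ∀ᵐ x ∂μ[|S ⁻¹' {i}], S x = i := ae_cond_mem (hS (measurableSet_singleton i))
    have h2 : ∀ᵐ y ∂ν[|T ⁻¹' {j}], T y = j := ae_cond_mem (hT (measurableSet_singleton j))
    have h3 : ∀ᵐ q ∂(μ[|S ⁻¹' {i}]).prod (ν[|T ⁻¹' {j}]), c (S q.1) (T q.2) ≤ c i j := by
      filter_upwards [Measure.quasiMeasurePreserving_fst.ae h1,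
        Measure.quasiMeasurePreserving_snd.ae h2] with q hq1 hq2
      rw [hq1, hq2]
    refine (lintegral_mono_ae h3).trans ?_
    rw [lintegral_const]
    refine mul_le_of_le_one_right' ?_
    rw [← Set.univ_prod_univ, Measure.prod_prod]
    exact mul_le_one' prob_le_one prob_le_one

end Gluing

/-! ### Kantorovich duality by quantization. -/

section Quantization

variable {d : ℕ} {μ ν : Measure (EuclideanSpace ℝ (Fin d))}

/-- Quantization of the identity with small mean square error. -/
lemma exists_simpleFunc_integral_sq_norm_sub_le (h2 : Integrable (fun x => ‖x‖ ^ 2) μ) {ε : ℝ}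
    (hε : 0 < ε) : ∃ s : SimpleFunc (EuclideanSpace ℝ (Fin d)) (EuclideanSpace ℝ (Fin d)),
      Integrable (fun x => ‖x - s x‖ ^ 2) μ ∧ ∫ x, ‖x - s x‖ ^ 2 ∂μ ≤ ε := by
  have hL : MemLp (fun x : EuclideanSpace ℝ (Fin d) => x) 2 μ :=
    (memLp_two_iff_integrable_sq_norm (by fun_prop)).2 h2
  obtain ⟨s, hs, hsL⟩ := hL.exists_simpleFunc_eLpNorm_sub_lt (by norm_num)
    (ε := ENNReal.ofReal (Real.sqrt ε)) (by simpa using hε)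
  have hd := hL.sub hsL
  have hi : Integrable (fun x => ‖x - s x‖ ^ 2) μ := (memLp_two_iff_integrable_sq_norm hd.1).1 hd
  refine ⟨s, hi, ?_⟩
  have h1 : eLpNorm ((fun x : EuclideanSpace ℝ (Fin d) => x) - ⇑s) 2 μ ^ 2 ≤ ENNReal.ofReal ε := by
    calc _ ≤ ENNReal.ofReal (Real.sqrt ε) ^ 2 := by gcongr
      _ = ENNReal.ofReal ε := by rw [← ENNReal.ofReal_pow (by positivity), Real.sq_sqrt hε.le]
  have h3 : eLpNorm ((fun x : EuclideanSpace ℝ (Fin d) => x) - ⇑s) 2 μ ^ 2 =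
      ENNReal.ofReal (∫ x, ‖x - s x‖ ^ 2 ∂μ) := by
    rw [ofReal_integral_eq_lintegral_ofReal hi (ae_of_all _ fun _ => by positivity)]
    have := eLpNorm_nnreal_pow_eq_lintegral (f := (fun x : EuclideanSpace ℝ (Fin d) => x) - ⇑s)
      (μ := μ) (p := 2) (by norm_num)
    norm_num at this
    rw [this]
    refine lintegral_congr fun x => ?_
    rw [ENNReal.ofReal_pow (norm_nonneg _), ofReal_norm]
  rwa [h3, ENNReal.ofReal_le_ofReal_iff hε.le] at h1

/-- Triangle inequality, then `(A + D)² ≤ (1 + η) A² + (1 + 1/η) D²` with `D = B + C`, and `D² ≤ 2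
(B² + C²)`. -/
lemma norm_sub_sq_le_of_approx {E : Type*} [SeminormedAddCommGroup E] (x y x' y' : E) {η : ℝ}
    (hη : 0 < η) : ‖x - y‖ ^ 2 ≤ (1 + η) * ‖x' - y'‖ ^ 2 +
      2 * (1 + 1 / η) * (‖x - x'‖ ^ 2 + ‖y - y'‖ ^ 2) := by
  have h1 : ‖x - y‖ ≤ ‖x' - y'‖ + (‖x - x'‖ + ‖y - y'‖) := by
    have h2 := norm_add_le (x' - y') ((x - x') - (y - y'))
    have h3 := norm_sub_le (x - x') (y - y')
    rw [show (x' - y') + ((x - x') - (y - y')) = x - y by abel] at h2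
    linarith
  set A := ‖x' - y'‖
  set B := ‖x - x'‖
  set C := ‖y - y'‖
  have h4 : ‖x - y‖ ^ 2 ≤ (A + (B + C)) ^ 2 := by gcongr
  have h5 : (1 + η) * A ^ 2 + (1 + 1 / η) * (B + C) ^ 2 - (A + (B + C)) ^ 2 =
      (η * A - (B + C)) ^ 2 / η := by field_simp; ring
  have h6 : 0 ≤ (η * A - (B + C)) ^ 2 / η := by positivity
  have h7 : (1 + 1 / η) * (B + C) ^ 2 ≤ (1 + 1 / η) * (2 * (B ^ 2 + C ^ 2)) := by
    gcongr; nlinarith [sq_nonneg (B - C)]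
  linarith

/-- Makes the potentials lifted from the finite problem admissible: `u` takes finitely many values
and `s` is bounded. -/
lemma isQuadraticallyBounded_of_simpleFunc
    (s : SimpleFunc (EuclideanSpace ℝ (Fin d)) (EuclideanSpace ℝ (Fin d)))
    (u : s.range → ℝ) {C r : ℝ} (hC : 0 ≤ C) (hr : 1 ≤ r) :
    IsQuadraticallyBounded fun x =>
      (u ⟨s x, SimpleFunc.mem_range_self s x⟩ - C * ‖x - s x‖ ^ 2) / r := by
  obtain ⟨U, hU⟩ : ∃ U, ∀ i, |u i| ≤ U := ⟨∑ i, |u i|, fun i =>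
    Finset.single_le_sum (f := fun i => |u i|) (fun i _ => abs_nonneg _) (Finset.mem_univ i)⟩
  obtain ⟨R, hR⟩ := s.exists_forall_norm_le
  have hU0 : 0 ≤ U := (abs_nonneg _).trans (hU ⟨s 0, SimpleFunc.mem_range_self s 0⟩)
  have hr0 : 0 < r := by linarith
  refine ⟨U + C * (2 + 2 * R ^ 2) + 1, by positivity, fun x => ?_⟩
  have h1 := abs_le.1 (hU ⟨s x, SimpleFunc.mem_range_self s x⟩)
  have h2 : C * ‖x - s x‖ ^ 2 ≤ C * (2 * ‖x‖ ^ 2 + 2 * R ^ 2) := by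
    have h3 : ‖x - s x‖ ^ 2 ≤ (‖x‖ + R) ^ 2 := by
      gcongr
      exact (norm_sub_le _ _).trans (by linarith [hR x])
    gcongr
    linarith [sq_nonneg (‖x‖ - R)]
  have h4 : 0 ≤ C * ‖x - s x‖ ^ 2 := by positivity
  have h5 : 0 ≤ C * R ^ 2 * ‖x‖ ^ 2 := by positivity
  have h6 : 0 ≤ U * ‖x‖ ^ 2 := by positivity
  have h7 : 0 ≤ C * R ^ 2 := by positivity
  have h8 := sq_nonneg ‖x‖
  constructor
  · rw [le_div_iff₀ hr0]
    have : -((U + C * (2 + 2 * R ^ 2) + 1) * (1 + ‖x‖ ^ 2)) * r ≤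
        -((U + C * (2 + 2 * R ^ 2) + 1) * (1 + ‖x‖ ^ 2)) * 1 :=
      mul_le_mul_of_nonpos_left hr (neg_nonpos.2 (by positivity))
    linarith
  · rw [div_le_iff₀ hr0]
    have : (U + C * (2 + 2 * R ^ 2) + 1) * 1 ≤ (U + C * (2 + 2 * R ^ 2) + 1) * r := by
      gcongr
    linarith

variable [IsProbabilityMeasure μ]

lemma integral_comp_eq_sum_range (s : SimpleFunc (EuclideanSpace ℝ (Fin d))
    (EuclideanSpace ℝ (Fin d))) (u : s.range → ℝ) :
    ∫ x, u ⟨s x, SimpleFunc.mem_range_self s x⟩ ∂μ =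
      ∑ i, u i * μ.real ((fun x => (⟨s x, SimpleFunc.mem_range_self s x⟩ : s.range)) ⁻¹' {i}) := by
  have hS : Measurable fun x => (⟨s x, SimpleFunc.mem_range_self s x⟩ : s.range) :=
    s.measurable.subtype_mk
  have := Measure.isProbabilityMeasure_map (μ := μ) hS.aemeasurable
  rw [← integral_map hS.aemeasurable (f := u) (by fun_prop), integral_fintype (.of_finite)]
  refine Finset.sum_congr rfl fun i _ => ?_
  rw [map_measureReal_apply hS (measurableSet_singleton i), smul_eq_mul, mul_comm]

variable [IsProbabilityMeasure ν]

/-- A coupling with controlled cost obtained from a bound on dual potentials, up to the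
quantization errors `ε` and `η`. -/
lemma iInf_couplings_le_of_quantization (hμ : Integrable (fun x => ‖x‖ ^ 2) μ)
    (hν : Integrable (fun x => ‖x‖ ^ 2) ν) {X : ℝ}
    (h : ∀ φ ψ : EuclideanSpace ℝ (Fin d) → ℝ, Measurable φ → Measurable ψ →
      IsQuadraticallyBounded φ → IsQuadraticallyBounded ψ →
      (∀ x y, φ x + ψ y ≤ ‖x - y‖ ^ 2) → ∫ x, φ x ∂μ + ∫ y, ψ y ∂ν ≤ X)
    {η ε : ℝ} (hη : 0 < η) (hε : 0 < ε) :
    ⨅ π ∈ couplings μ ν, ∫⁻ q, ‖q.1 - q.2‖ₑ ^ 2 ∂π ≤ ENNReal.ofReal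
      ((1 + η) * ((1 + η) * X + 2 * (2 * (1 + 1 / η)) * ε) + 2 * (2 * (1 + 1 / η)) * ε) := by
  set C := 2 * (1 + 1 / η)
  have hC : 0 < C := by positivity
  obtain ⟨s, hsi, hs⟩ := exists_simpleFunc_integral_sq_norm_sub_le hμ hε
  obtain ⟨t, hti, ht⟩ := exists_simpleFunc_integral_sq_norm_sub_le hν hε
  set S : EuclideanSpace ℝ (Fin d) → s.range := fun x => ⟨s x, SimpleFunc.mem_range_self s x⟩
  set T : EuclideanSpace ℝ (Fin d) → t.range := fun x => ⟨t x, SimpleFunc.mem_range_self t x⟩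
  have hS : Measurable S := s.measurable.subtype_mk
  have hT : Measurable T := t.measurable.subtype_mk
  have hone : ∀ (m : Measure (EuclideanSpace ℝ (Fin d))) [IsProbabilityMeasure m]
      (r : SimpleFunc (EuclideanSpace ℝ (Fin d)) (EuclideanSpace ℝ (Fin d))),
      ∑ i, m.real ((fun x => (⟨r x, SimpleFunc.mem_range_self r x⟩ : r.range)) ⁻¹' {i}) = 1 := by
    intro m _ r
    have := integral_comp_eq_sum_range (μ := m) r (fun _ => 1)
    simpa using this.symm
  have hint : ∀ (m : Measure (EuclideanSpace ℝ (Fin d))) [IsProbabilityMeasure m]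
      (r : SimpleFunc (EuclideanSpace ℝ (Fin d)) (EuclideanSpace ℝ (Fin d)))
      (u : r.range → ℝ), Integrable (fun x => u ⟨r x, SimpleFunc.mem_range_self r x⟩) m := by
    intro m _ r u
    have hr : Measurable fun x => (⟨r x, SimpleFunc.mem_range_self r x⟩ : r.range) :=
      r.measurable.subtype_mk
    have := Measure.isProbabilityMeasure_map (μ := m) hr.aemeasurable
    exact (Integrable.of_finite (f := u)).comp_measurable hr
  obtain ⟨p, hp, hrow, hcol, hcost⟩ := exists_finite_plan
    (a := fun i => μ.real (S ⁻¹' {i})) (b := fun j => ν.real (T ⁻¹' {j}))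
    (fun _ => measureReal_nonneg) (fun _ => measureReal_nonneg) (hone μ s) (hone ν t)
    (fun i j => ‖(i : EuclideanSpace ℝ (Fin d)) - j‖ ^ 2)
    (X := (1 + η) * X + 2 * C * ε) fun u v huv => by
      -- Subtracting the quantization error and dividing by `1 + η` turns feasibility for the cost
      -- between quantized points into feasibility for `‖x - y‖²`.
      have h1 := h (fun x => (u (S x) - C * ‖x - s x‖ ^ 2) / (1 + η))
        (fun y => (v (T y) - C * ‖y - t y‖ ^ 2) / (1 + η))
        (by have : Measurable u := measurable_of_finite u
            have := s.measurable
            fun_prop)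
        (by have : Measurable v := measurable_of_finite v
            have := t.measurable
            fun_prop)
        (isQuadraticallyBounded_of_simpleFunc s u hC.le (by linarith))
        (isQuadraticallyBounded_of_simpleFunc t v hC.le (by linarith)) fun x y => by
          rw [← add_div, div_le_iff₀ (by positivity)]
          have h2 := huv (S x) (T y)
          have h3 := norm_sub_sq_le_of_approx (s x) (t y) x y hη
          rw [norm_sub_rev (s x) x, norm_sub_rev (t y) y] at h3
          simp only [S, T] at h2 ⊢
          linarith
      rw [integral_div, integral_div, ← add_div, div_le_iff₀ (by positivity),
        integral_sub (hint μ s u) (hsi.const_mul C), integral_sub (hint ν t v) (hti.const_mul C),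
        integral_const_mul, integral_const_mul, integral_comp_eq_sum_range,
        integral_comp_eq_sum_range] at h1
      have h4 := mul_le_mul_of_nonneg_left hs hC.le
      have h5 := mul_le_mul_of_nonneg_left ht hC.le
      linarith
  obtain ⟨π, hπ1, hπ2, hπ⟩ := exists_coupling_of_finite_plan μ ν hS hT hp hrow hcol
  refine (iInf₂_le π ⟨hπ1, hπ2⟩).trans ?_
  have hπc := hπ fun i j => ENNReal.ofReal (‖(i : EuclideanSpace ℝ (Fin d)) - j‖ ^ 2)
  have hXC : 0 ≤ (1 + η) * X + 2 * C * ε :=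
    (Finset.sum_nonneg fun i _ => Finset.sum_nonneg fun j _ =>
      mul_nonneg (hp i j) (by positivity)).trans hcost
  have hcost' : ∑ i, ∑ j, ENNReal.ofReal (p i j) *
      ENNReal.ofReal (‖(i : EuclideanSpace ℝ (Fin d)) - j‖ ^ 2) ≤
      ENNReal.ofReal ((1 + η) * X + 2 * C * ε) := by
    refine le_trans (le_of_eq ?_) (ENNReal.ofReal_le_ofReal hcost)
    rw [ENNReal.ofReal_sum_of_nonneg fun i _ => Finset.sum_nonneg fun j _ =>
      mul_nonneg (hp i j) (by positivity)]
    refine Finset.sum_congr rfl fun i _ => ?_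
    rw [ENNReal.ofReal_sum_of_nonneg fun j _ => mul_nonneg (hp i j) (by positivity)]
    exact Finset.sum_congr rfl fun j _ => (ENNReal.ofReal_mul (hp i j)).symm
  have herr : ∀ (m : Measure (EuclideanSpace ℝ (Fin d)))
      (r : SimpleFunc (EuclideanSpace ℝ (Fin d)) (EuclideanSpace ℝ (Fin d))),
      Integrable (fun x => ‖x - r x‖ ^ 2) m → ∫ x, ‖x - r x‖ ^ 2 ∂m ≤ ε →
      ∫⁻ x, ENNReal.ofReal (‖x - r x‖ ^ 2) ∂m ≤ ENNReal.ofReal ε := by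
    intro m r hi hr
    rw [← ofReal_integral_eq_lintegral_ofReal hi (ae_of_all _ fun _ => by positivity)]
    exact ENNReal.ofReal_le_ofReal hr
  have hms : Measurable fun x => ENNReal.ofReal (‖x - s x‖ ^ 2) := by
    have := s.measurable
    fun_prop
  have hmt : Measurable fun x => ENNReal.ofReal (‖x - t x‖ ^ 2) := by
    have := t.measurable
    fun_prop
  have h1 : ∫⁻ q, ENNReal.ofReal (‖q.1 - s q.1‖ ^ 2) ∂π ≤ ENNReal.ofReal ε := by
    rw [← lintegral_map hms measurable_fst, hπ1]
    exact herr μ s hsi hs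
  have h2 : ∫⁻ q, ENNReal.ofReal (‖q.2 - t q.2‖ ^ 2) ∂π ≤ ENNReal.ofReal ε := by
    rw [← lintegral_map hmt measurable_snd, hπ2]
    exact herr ν t hti ht
  have hms' : Measurable fun q : EuclideanSpace ℝ (Fin d) × EuclideanSpace ℝ (Fin d) =>
      ENNReal.ofReal (‖q.1 - s q.1‖ ^ 2) := hms.comp measurable_fst
  have hmt' : Measurable fun q : EuclideanSpace ℝ (Fin d) × EuclideanSpace ℝ (Fin d) =>
      ENNReal.ofReal (‖q.2 - t q.2‖ ^ 2) := hmt.comp measurable_snd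
  -- Returning from quantized points to the original ones costs a second factor `1 + η`.
  calc ∫⁻ q, ‖q.1 - q.2‖ₑ ^ 2 ∂π
      ≤ ∫⁻ q, (ENNReal.ofReal (1 + η) * ENNReal.ofReal (‖s q.1 - t q.2‖ ^ 2) +
          ENNReal.ofReal C * (ENNReal.ofReal (‖q.1 - s q.1‖ ^ 2) +
            ENNReal.ofReal (‖q.2 - t q.2‖ ^ 2))) ∂π := by
        refine lintegral_mono fun q => ?_
        simp only
        rw [← ofReal_norm, ← ENNReal.ofReal_pow (norm_nonneg _), ← ENNReal.ofReal_mul (by positivity),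
          ← ENNReal.ofReal_add (by positivity) (by positivity), ← ENNReal.ofReal_mul (by positivity),
          ← ENNReal.ofReal_add (by positivity) (by positivity)]
        exact ENNReal.ofReal_le_ofReal (norm_sub_sq_le_of_approx _ _ _ _ hη)
    _ = ENNReal.ofReal (1 + η) * ∫⁻ q, ENNReal.ofReal (‖s q.1 - t q.2‖ ^ 2) ∂π +
          ENNReal.ofReal C * (∫⁻ q, ENNReal.ofReal (‖q.1 - s q.1‖ ^ 2) ∂π +
            ∫⁻ q, ENNReal.ofReal (‖q.2 - t q.2‖ ^ 2) ∂π) := by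
        rw [lintegral_add_right _ (by fun_prop), lintegral_const_mul' _ _ ENNReal.ofReal_ne_top,
          lintegral_const_mul' _ _ ENNReal.ofReal_ne_top, lintegral_add_right _ hmt']
    _ ≤ ENNReal.ofReal (1 + η) * ENNReal.ofReal ((1 + η) * X + 2 * C * ε) +
          ENNReal.ofReal C * (ENNReal.ofReal ε + ENNReal.ofReal ε) := by
        gcongr
        exact hπc.trans hcost'
    _ = _ := by
        rw [← ENNReal.ofReal_mul (by positivity), ← ENNReal.ofReal_add hε.le hε.le,
          ← ENNReal.ofReal_mul hC.le, ← ENNReal.ofReal_add (by positivity) (by positivity)]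
        congr 1
        ring

/-- The hard half of Kantorovich duality for the quadratic cost. -/
lemma sq_wassersteinTwo_le_of_dual (hμ : Integrable (fun x => ‖x‖ ^ 2) μ)
    (hν : Integrable (fun x => ‖x‖ ^ 2) ν) {X : ℝ}
    (h : ∀ φ ψ : EuclideanSpace ℝ (Fin d) → ℝ, Measurable φ → Measurable ψ →
      IsQuadraticallyBounded φ → IsQuadraticallyBounded ψ →
      (∀ x y, φ x + ψ y ≤ ‖x - y‖ ^ 2) → ∫ x, φ x ∂μ + ∫ y, ψ y ∂ν ≤ X) :
    wassersteinTwo μ ν ^ 2 ≤ ENNReal.ofReal X := by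
  -- The limit `ε → 0` comes first, because the error coefficient contains `1 / η`.
  have h1 : ∀ η : ℝ, 0 < η → ⨅ π ∈ couplings μ ν, ∫⁻ q, ‖q.1 - q.2‖ₑ ^ 2 ∂π ≤
      ENNReal.ofReal ((1 + η) * ((1 + η) * X)) := by
    intro η hη
    have hlim : Filter.Tendsto (fun ε : ℝ => ENNReal.ofReal
        ((1 + η) * ((1 + η) * X + 2 * (2 * (1 + 1 / η)) * ε) + 2 * (2 * (1 + 1 / η)) * ε))
        (nhdsWithin 0 (Set.Ioi 0)) (nhds (ENNReal.ofReal ((1 + η) * ((1 + η) * X)))) := by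
      refine (ENNReal.tendsto_ofReal ?_).mono_left nhdsWithin_le_nhds
      refine Continuous.tendsto' (by fun_prop) _ _ (by ring)
    refine ge_of_tendsto hlim ?_
    filter_upwards [self_mem_nhdsWithin] with ε hε
    exact iInf_couplings_le_of_quantization hμ hν h hη hε
  have hlim : Filter.Tendsto (fun η : ℝ => ENNReal.ofReal ((1 + η) * ((1 + η) * X)))
      (nhdsWithin 0 (Set.Ioi 0)) (nhds (ENNReal.ofReal X)) := by
    refine (ENNReal.tendsto_ofReal ?_).mono_left nhdsWithin_le_nhds
    refine Continuous.tendsto' (by fun_prop) _ _ (by ring)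
  rw [wassersteinTwo, ← ENNReal.rpow_natCast, ← ENNReal.rpow_mul]
  norm_num
  refine ge_of_tendsto hlim ?_
  filter_upwards [self_mem_nhdsWithin] with η hη
  exact h1 η hη

end Quantization

/-- The functional Santaló inequality implies the symmetrized Talagrand inequality. -/
lemma FunctionalSantaloInequality.symmetrizedTalagrandInequality {d : ℕ}
    (H : FunctionalSantaloInequality d) : SymmetrizedTalagrandInequality d := by
  intro μ ν _ _ hc
  by_cases hμ : klDiv μ (stdGaussian (EuclideanSpace ℝ (Fin d))) = ∞
  · simp [hμ]
  by_cases hν : klDiv ν (stdGaussian (EuclideanSpace ℝ (Fin d))) = ∞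
  · simp [hν]
  refine (sq_wassersteinTwo_le_of_dual (integrable_sq_norm_of_klDiv_ne_top hμ)
    (integrable_sq_norm_of_klDiv_ne_top hν) fun φ ψ hφm hψm hφ hψ hle =>
      H.integral_add_integral_le hc hμ hν hφm hψm hφ hψ hle).trans (le_of_eq ?_)
  rw [ENNReal.ofReal_add (by positivity) (by positivity), ENNReal.ofReal_mul zero_le_two,
    ENNReal.ofReal_mul zero_le_two, ENNReal.ofReal_toReal hμ, ENNReal.ofReal_toReal hν]
  norm_num

/-! ### Integrability and entropy of the densities in Santaló's inequality. -/

section LinearDecay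

variable {d : ℕ} {f : EuclideanSpace ℝ (Fin d) → ℝ}

/-- Upper bound by a function decreasing linearly in the norm. -/
def HasLinearDecay (f : EuclideanSpace ℝ (Fin d) → ℝ) : Prop :=
  ∃ C c : ℝ, 0 < c ∧ ∀ x, f x ≤ C - c * ‖x‖

lemma HasLinearDecay.const_mul (hf : HasLinearDecay f) {r : ℝ} (hr : 0 < r) :
    HasLinearDecay fun x => r * f x := by
  obtain ⟨C, c, hc, h⟩ := hf
  exact ⟨r * C, r * c, by positivity, fun x => by
    linarith [mul_le_mul_of_nonneg_left (h x) hr.le]⟩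

/-- One term of the exponential series gives domination by `(1 + ‖x‖)^(-(d+1))`, whose exponent just
exceeds the dimension. -/
lemma integrable_exp_neg_mul_norm {c : ℝ} (hc : 0 < c) :
    Integrable (fun x : EuclideanSpace ℝ (Fin d) => Real.exp (-(c * ‖x‖))) := by
  have h0 : Integrable (fun x : EuclideanSpace ℝ (Fin d) => (1 + ‖x‖) ^ (-((d + 1 : ℕ) : ℝ))) :=
    integrable_one_add_norm (by simp)
  refine (h0.const_mul (Real.exp c * (d + 1).factorial / c ^ (d + 1))).mono' (by fun_prop)
    (ae_of_all _ fun x => ?_)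
  have h1 := Real.pow_div_factorial_le_exp (c * (1 + ‖x‖)) (by positivity) (d + 1)
  rw [Real.norm_of_nonneg (Real.exp_pos _).le, Real.rpow_neg (by positivity), Real.rpow_natCast,
    ← div_eq_mul_inv, div_div, le_div_iff₀ (by positivity), ← mul_pow]
  rw [div_le_iff₀ (by positivity)] at h1
  calc Real.exp (-(c * ‖x‖)) * (c * (1 + ‖x‖)) ^ (d + 1)
      ≤ Real.exp (-(c * ‖x‖)) * (Real.exp (c * (1 + ‖x‖)) * (d + 1).factorial) := by gcongr
    _ = Real.exp c * (d + 1).factorial := by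
      rw [← mul_assoc, ← Real.exp_add]
      congr 2
      ring

lemma HasLinearDecay.integrable_exp (hf : HasLinearDecay f) (hm : Measurable f) :
    Integrable (fun x => Real.exp (f x)) := by
  obtain ⟨C, c, hc, h⟩ := hf
  refine ((integrable_exp_neg_mul_norm hc).const_mul (Real.exp C)).mono' (by fun_prop)
    (ae_of_all _ fun x => ?_)
  rw [Real.norm_of_nonneg (Real.exp_pos _).le, ← Real.exp_add, Real.exp_le_exp]
  linarith [h x]

/-- No lower bound on `f` is available, so `|t| e^t ≤ 2 e^(t/2) + e^(2t)` controls both signs by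
exponentials of functions with linear decay. -/
lemma HasLinearDecay.integrable_exp_mul_self (hf : HasLinearDecay f) (hm : Measurable f) :
    Integrable (fun x => Real.exp (f x) • f x) := by
  have h1 := (hf.const_mul (r := 1 / 2) (by norm_num)).integrable_exp (by fun_prop)
  have h2 := (hf.const_mul (r := 2) (by norm_num)).integrable_exp (by fun_prop)
  refine ((h1.const_mul 2).add h2).mono' (by fun_prop) (ae_of_all _ fun x => ?_)
  rw [norm_smul, Real.norm_of_nonneg (Real.exp_pos _).le, Real.norm_eq_abs, Pi.add_apply]
  have e1 : Real.exp (2 * f x) = Real.exp (f x) * Real.exp (f x) := by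
    rw [← Real.exp_add]; congr 1; ring
  have e2 : Real.exp (1 / 2 * f x) = Real.exp (f x) * Real.exp (-(f x) / 2) := by
    rw [← Real.exp_add]; congr 1; ring
  rw [e1, e2, ← mul_assoc, mul_comm 2, mul_assoc, ← mul_add]
  gcongr
  have h3 := Real.add_one_le_exp (f x)
  have h4 := Real.add_one_le_exp (-(f x) / 2)
  exact abs_le.2 ⟨by linarith [Real.exp_pos (f x)], by linarith [Real.exp_pos (-(f x) / 2)]⟩

lemma HasLinearDecay.integrable_exp_mul_sq_norm (hf : HasLinearDecay f) (hm : Measurable f) :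
    Integrable (fun x => Real.exp (f x) • ‖x‖ ^ 2) := by
  obtain ⟨C, c, hc, h⟩ := hf
  refine ((integrable_exp_neg_mul_norm (c := c / 2) (by positivity)).const_mul
    (Real.exp C * (8 / c ^ 2))).mono' (by fun_prop) (ae_of_all _ fun x => ?_)
  have h1 := Real.pow_div_factorial_le_exp (c / 2 * ‖x‖) (by positivity) 2
  have h2 : ‖x‖ ^ 2 ≤ 8 / c ^ 2 * Real.exp (c / 2 * ‖x‖) := by
    calc ‖x‖ ^ 2 = 8 / c ^ 2 * ((c / 2 * ‖x‖) ^ 2 / (2 : ℕ).factorial) := by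
          norm_num [Nat.factorial]; field_simp; norm_num
      _ ≤ _ := by gcongr
  rw [norm_smul, Real.norm_of_nonneg (Real.exp_pos _).le, Real.norm_of_nonneg (by positivity)]
  calc Real.exp (f x) * ‖x‖ ^ 2
      ≤ Real.exp (C - c * ‖x‖) * (8 / c ^ 2 * Real.exp (c / 2 * ‖x‖)) := by
        gcongr; exact h x
    _ = Real.exp (C - c * ‖x‖) * Real.exp (c / 2 * ‖x‖) * (8 / c ^ 2) := by ring
    _ = Real.exp C * (8 / c ^ 2) * Real.exp (-(c / 2 * ‖x‖)) := by
        rw [← Real.exp_add, mul_right_comm, ← Real.exp_add]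
        congr 2
        ring

/-- Since `g` is finite at `0` and `±e i`, testing `y` at these finitely many points bounds every
`|x i|` by `C - f x`. -/
lemma hasLinearDecay_of_add_le_neg_inner {g : EuclideanSpace ℝ (Fin d) → ℝ}
    (h : ∀ x y, f x + g y ≤ -⟪x, y⟫) : HasLinearDecay f := by
  set e : Fin d → EuclideanSpace ℝ (Fin d) := fun i => EuclideanSpace.single i 1
  set C := |g 0| + ∑ i, (|g (e i)| + |g (-e i)|)
  have hC : ∀ i, |g (e i)| + |g (-e i)| ≤ C := fun i =>
    (Finset.single_le_sum (f := fun i => |g (e i)| + |g (-e i)|) (fun i _ => by positivity)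
      (Finset.mem_univ i)).trans (le_add_of_nonneg_left (abs_nonneg _))
  have h0 : ∀ x, 0 ≤ C - f x := fun x => by
    have h1 := h x 0
    rw [inner_zero_right] at h1
    have h2 : |g 0| ≤ C :=
      le_add_of_nonneg_right (Finset.sum_nonneg fun i _ => by positivity)
    linarith [neg_abs_le (g 0)]
  have hi : ∀ x : EuclideanSpace ℝ (Fin d), ∀ i, |x i| ≤ C - f x := fun x i => by
    have h1 := h x (e i)
    have h2 := h x (-e i)
    have hx : ⟪x, e i⟫ = x i := by simp [e, EuclideanSpace.inner_single_right]
    rw [inner_neg_right, hx] at h2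
    rw [hx] at h1
    have := hC i
    rw [abs_le]
    constructor <;>
      linarith [neg_abs_le (g (e i)), neg_abs_le (g (-e i)), abs_nonneg (g (e i)),
        abs_nonneg (g (-e i))]
  -- Taking `d + 1` instead of `d` keeps the slope meaningful when `d = 0`; the extra `C - f x` is
  -- nonnegative.
  refine ⟨C, 1 / (d + 1), by positivity, fun x => ?_⟩
  have hn : ‖x‖ ≤ ∑ i, |x i| := by
    rw [EuclideanSpace.norm_eq]
    refine Real.sqrt_le_iff.2 ⟨Finset.sum_nonneg fun i _ => abs_nonneg _, ?_⟩
    simp_rw [Real.norm_eq_abs]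
    exact Finset.sum_sq_le_sq_sum_of_nonneg fun i _ => abs_nonneg _
  have hs : ∑ i, |x i| ≤ d * (C - f x) := by
    refine (Finset.sum_le_sum fun i _ => hi x i).trans (le_of_eq ?_)
    rw [Finset.sum_const, Finset.card_univ, Fintype.card_fin, nsmul_eq_mul]
  have : 1 / (d + 1 : ℝ) * ‖x‖ ≤ C - f x := by
    rw [div_mul_eq_mul_div, div_le_iff₀ (by positivity)]
    linarith [h0 x]
  linarith

lemma HasLinearDecay.integrable_self_tilted (hf : HasLinearDecay f) (hm : Measurable f) :
    Integrable f (volume.tilted f) :=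
  (integrable_tilted_iff (hf.integrable_exp hm) _).2 (hf.integrable_exp_mul_self hm)

lemma HasLinearDecay.integrable_sq_norm_tilted (hf : HasLinearDecay f) (hm : Measurable f) :
    Integrable (fun x => ‖x‖ ^ 2) (volume.tilted f) :=
  (integrable_tilted_iff (hf.integrable_exp hm) _).2 (hf.integrable_exp_mul_sq_norm hm)

/-- The relative entropy of `e ^ f / ∫ e ^ f` with respect to the standard Gaussian measure. -/
lemma HasLinearDecay.klDiv_tilted (hf : HasLinearDecay f) (hm : Measurable f) :
    klDiv (volume.tilted f) (stdGaussian (EuclideanSpace ℝ (Fin d))) ≠ ∞ ∧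
      2 * (klDiv (volume.tilted f) (stdGaussian (EuclideanSpace ℝ (Fin d)))).toReal =
        ∫ x, (‖x‖ ^ 2 + 2 * f x) ∂(volume.tilted f) -
          2 * Real.log ((∫ x, Real.exp (f x)) / (2 * Real.pi) ^ (d / 2 : ℝ)) := by
  -- Relative to the Gaussian, the log-density is `f + ‖x‖² / 2` up to a constant.
  have htilt : volume.tilted f = (stdGaussian (EuclideanSpace ℝ (Fin d))).tilted
      (fun x => f x + ‖x‖ ^ 2 / 2) := by
    rw [stdGaussian_eq_tilted, tilted_tilted integrable_exp_neg_half_sq_norm]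
    congr 1 with x
    simp
  have hexp : Integrable (fun x => Real.exp (f x + ‖x‖ ^ 2 / 2))
      (stdGaussian (EuclideanSpace ℝ (Fin d))) := by
    rw [integrable_exp_stdGaussian_iff]
    simpa using hf.integrable_exp hm
  have hint : Integrable (fun x => f x + ‖x‖ ^ 2 / 2) (volume.tilted f) :=
    (hf.integrable_self_tilted hm).add ((hf.integrable_sq_norm_tilted hm).div_const 2)
  obtain ⟨h1, h2⟩ := klDiv_tilted_left hexp (htilt ▸ hint)
  rw [← htilt] at h1 h2
  refine ⟨h1, ?_⟩
  rw [h2, integral_exp_stdGaussian, mul_sub, ← integral_const_mul]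
  simp only [add_sub_cancel_right]
  congr 2 with x
  ring

end LinearDecay

/-! ### From Talagrand to Santaló. -/

/-- The easy half of Kantorovich duality for the quadratic cost. -/
lemma ofReal_integral_add_integral_le_sq_wassersteinTwo {d : ℕ}
    {μ ν : Measure (EuclideanSpace ℝ (Fin d))}
    {φ ψ : EuclideanSpace ℝ (Fin d) → ℝ} (hφ : Integrable φ μ) (hψ : Integrable ψ ν)
    (hle : ∀ x y, φ x + ψ y ≤ ‖x - y‖ ^ 2) :
    ENNReal.ofReal (∫ x, φ x ∂μ + ∫ y, ψ y ∂ν) ≤ wassersteinTwo μ ν ^ 2 := by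
  rw [wassersteinTwo, ← ENNReal.rpow_natCast, ← ENNReal.rpow_mul]
  norm_num
  intro π ⟨h1, h2⟩
  subst h1 h2
  have hφ' : Integrable (fun q => φ q.1) π := hφ.comp_measurable measurable_fst
  have hψ' : Integrable (fun q => ψ q.2) π := hψ.comp_measurable measurable_snd
  rw [integral_map measurable_fst.aemeasurable hφ.1, integral_map measurable_snd.aemeasurable hψ.1,
    ← integral_add hφ' hψ']
  have hlin : ∫⁻ q, ENNReal.ofReal (φ q.1 + ψ q.2) ∂π ≤ ∫⁻ q, ‖q.1 - q.2‖ₑ ^ 2 ∂π := by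
    refine lintegral_mono fun q => ?_
    simp only
    rw [← ofReal_norm, ← ENNReal.ofReal_pow (norm_nonneg _)]
    exact ENNReal.ofReal_le_ofReal (hle _ _)
  refine le_trans ?_ hlin
  have hparts := integral_eq_lintegral_pos_part_sub_lintegral_neg_part (hφ'.add hψ')
  simp only [Pi.add_apply] at hparts
  rw [hparts]
  refine (ENNReal.ofReal_le_ofReal (sub_le_self _ ENNReal.toReal_nonneg)).trans ?_
  exact ENNReal.ofReal_toReal_le

lemma ExpHasBarycenterZero.isCentered_tilted {d : ℕ} {f : EuclideanSpace ℝ (Fin d) → ℝ}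
    (hf : ExpHasBarycenterZero f) : IsCentered (volume.tilted f) := by
  refine ⟨(integrable_tilted_iff hf.1 _).2 hf.2.1, ?_⟩
  rw [integral_tilted]
  simp_rw [div_eq_inv_mul, ← smul_smul]
  rw [integral_smul, hf.2.2, smul_zero]

lemma SymmetrizedTalagrandInequality.lintegral_mul_lintegral_le {d : ℕ}
    (H : SymmetrizedTalagrandInequality d) {f g : EuclideanSpace ℝ (Fin d) → ℝ}
    (hfm : Measurable f) (hgm : Measurable g) (hle : ∀ x y, f x + g y ≤ -⟪x, y⟫)
    (hf0 : ExpHasBarycenterZero f) :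
    (∫⁻ x, ENNReal.ofReal (Real.exp (f x))) * (∫⁻ y, ENNReal.ofReal (Real.exp (g y))) ≤
      ENNReal.ofReal ((2 * Real.pi) ^ d) := by
  have hf := hasLinearDecay_of_add_le_neg_inner hle
  have hg := hasLinearDecay_of_add_le_neg_inner (f := g) (g := f) fun x y => by
    rw [add_comm, real_inner_comm]; exact hle y x
  have hfe := hf.integrable_exp hfm
  have hge := hg.integrable_exp hgm
  obtain ⟨hf1, hf2⟩ := hf.klDiv_tilted hfm
  obtain ⟨hg1, hg2⟩ := hg.klDiv_tilted hgm
  -- The potentials `‖x‖² + 2f` and `‖y‖² + 2g` are exactly the integrands in the doubled entropies,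
  -- so their integrals cancel below.
  have h1 := (ofReal_integral_add_integral_le_sq_wassersteinTwo
    ((hf.integrable_sq_norm_tilted hfm).add ((hf.integrable_self_tilted hfm).const_mul 2))
    ((hg.integrable_sq_norm_tilted hgm).add ((hg.integrable_self_tilted hgm).const_mul 2))
    fun x y => by
      simp only [Pi.add_apply]
      rw [norm_sub_sq_real]
      linarith [hle x y]).trans
    (H _ _ (isProbabilityMeasure_tilted hfe) (isProbabilityMeasure_tilted hge)
      hf0.isCentered_tilted)
  simp only [Pi.add_apply] at h1
  have htwo : ∀ t : ℝ≥0∞, t ≠ ∞ → 2 * t = ENNReal.ofReal (2 * t.toReal) := fun t ht => by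
    rw [ENNReal.ofReal_mul zero_le_two, ENNReal.ofReal_toReal ht]
    norm_num
  rw [htwo _ hf1, htwo _ hg1, ← ENNReal.ofReal_add (by positivity) (by positivity),
    ENNReal.ofReal_le_ofReal_iff (by positivity), hf2, hg2] at h1
  have hZf := integral_exp_pos hfe
  have hZg := integral_exp_pos hge
  rw [← ofReal_integral_eq_lintegral_ofReal hfe (ae_of_all _ fun _ => (Real.exp_pos _).le),
    ← ofReal_integral_eq_lintegral_ofReal hge (ae_of_all _ fun _ => (Real.exp_pos _).le),
    ← ENNReal.ofReal_mul hZf.le]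
  refine ENNReal.ofReal_le_ofReal ?_
  have hlog : Real.log ((∫ x, Real.exp (f x)) / (2 * Real.pi) ^ (d / 2 : ℝ) *
      ((∫ x, Real.exp (g x)) / (2 * Real.pi) ^ (d / 2 : ℝ))) ≤ 0 := by
    rw [Real.log_mul (by positivity) (by positivity)]
    linarith
  rwa [Real.log_nonpos_iff (by positivity), div_mul_div_comm, div_le_one (by positivity),
    ← Real.rpow_add (by positivity), add_halves, Real.rpow_natCast] at hlog

theorem mainTheorem2 (d : ℕ) :
    SymmetrizedTalagrandInequality d ↔ FunctionalSantaloInequality d := by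
  refine ⟨fun H f g hf hg hle h => ?_, fun H => H.symmetrizedTalagrandInequality⟩
  rcases h with h | h
  · exact H.lintegral_mul_lintegral_le hf hg hle h
  · rw [mul_comm]
    exact H.lintegral_mul_lintegral_le hg hf
      (fun x y => by rw [add_comm, real_inner_comm]; exact hle y x) h
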